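/- Let $(\mathcal X_i,d_i)$, $i\ge 1$, be Hadamard spaces, i.e. complete, uniquely geodesic metric spaces satisfying the CAT(0) inequality $$d_i([x,y]_t,z)^2\le(1-t)\,d_i(x,z)^2+t\,d_i(y,z)^2-t(1-t)\,d_i(x,y)^2\qquad(t\in[0,1]),$$ where $t\mapsto[x,y]_t$, $t\in[0,1]$, is the geodesic from $x$ to $y$; each is equipped with its Borel $\sigma$-algebra. For $n\ge1$ let $\mathcal X^{(n)}=\mathcal X_1\times\cdots\times\mathcal X_n$ with the metric $d(x,y)=\big(\frac1n\sum_{i=1}^n d_i(x_i,y_i)^2\big)^{1/2}$, whose geodesics are $[x,y]_t=([x_1,y_1]_t,\dots,[x_n,y_n]_t)$. For a distribution $P$ on a metric space with metric $d$, and $X\sim P$, the Fréchet mean $E_2P$ is the minimizer of $x\mapsto E\,d(x,X)^2$, and the Fréchet variance is $V_2P=\inf_x E\,d(x,X)^2$. Fix $\sigma^2$ and a sequence $m=(m_c)_{c\ge1}$ of positive real numbers, and let $\mathcal P_m^{(n)}$ be the set of product distributions $P=P_1\times\cdots\times P_n$ on $\mathcal X^{(n)}$ with $V_2P=\sigma^2$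 and $0<E\big(d_i(X_i,E_2P_i)^c\big)\le m_c$ for $X_i\sim P_i$, all integers $c\ge1$ and all $i=1,\dots,n$. For a point $\psi^{(n)}\in\mathcal X^{(n)}$ the geodesic James–Stein estimator with shrinkage point $\psi^{(n)}$ is $$\delta_{JS}(X)=[X,\psi^{(n)}]_{w(X)},\qquad w(X)=\min\Big(1,\frac{\sigma^2}{d(X,\psi^{(n)})^2}\Big).$$ The loss is $L(\theta,a)=d(\theta,a)^2$, and the risk of an estimator $\delta$ at $P$ is $R(P,\delta)=E\,L(E_2P,\delta(X))$ with $X\sim P$. For every $n\ge1$ let $X^{(n)}\sim P^{(n)}\in\mathcal P_m^{(n)}$ have Fréchet mean $\theta^{(n)}$, and let $(\psi^{(n)})_{n\ge1}$ be any sequence of shrinkage points $\psi^{(n)}\in\mathcal X^{(n)}$. Then: 1. If $d(\theta^{(n)},\psi^{(n)})^2\to\infty$, then $\limsup_n R(P^{(n)},\delta_{JS}(X^{(n)}))=\sigma^2$. 2. For any sequence $(\psi^{(n)})$, $\lim_n R(P^{(n)},X^{(n)})$ exists and equals $\sigma^2$, and $\limsup_n R(P^{(n)},\delta_{JS}(X^{(n)}))\le\lim_n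 R(P^{(n)},X^{(n)})=\sigma^2$. 3. For any sequence $(\psi^{(n)})$ and every $\epsilon>0$, $\lim_n P\big(L(\theta^{(n)},\delta_{JS}(X^{(n)}))>\sigma^2+\epsilon\big)=0$. -/

import Mathlib

open MeasureTheory Filter Topology

noncomputable section

/-- `γ`, restricted to `[0, 1]`, is a (constant speed) geodesic from `x` to `y`. -/
def IsGeodesicFromTo {E : Type*} [MetricSpace E] (x y : E) (γ : ℝ → E) : Prop :=
  γ 0 = x ∧ γ 1 = y ∧
    ∀ s ∈ Set.Icc (0 : ℝ) 1, ∀ t ∈ Set.Icc (0 : ℝ) 1, dist (γ s) (γ t) = dist x y * |s - t|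

/-- Hadamard spaces: complete, uniquely geodesic metric spaces that satisfy the `CAT(0)`
inequality. -/
class HadamardSpace (E : Type*) [MetricSpace E] : Prop where
  complete : CompleteSpace E
  exists_geodesic : ∀ x y : E, ∃ γ : ℝ → E, IsGeodesicFromTo x y γ
  unique_geodesic : ∀ (x y : E) (γ₁ γ₂ : ℝ → E), IsGeodesicFromTo x y γ₁ →
    IsGeodesicFromTo x y γ₂ → Set.EqOn γ₁ γ₂ (Set.Icc 0 1)
  cat0 : ∀ (x y z : E) (γ : ℝ → E), IsGeodesicFromTo x y γ → ∀ t ∈ Set.Icc (0 : ℝ) 1,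
    dist (γ t) z ^ 2 ≤
      (1 - t) * dist x z ^ 2 + t * dist y z ^ 2 - t * (1 - t) * dist x y ^ 2

/-- The point `[x, y]_t`, for `t ∈ [0, 1]`, on the unique geodesic from `x` to `y`. -/
def geodesicPoint {E : Type*} [MetricSpace E] [HadamardSpace E] (x y : E) (t : ℝ) : E :=
  Classical.choose (HadamardSpace.exists_geodesic x y) t

/-- `E (d(x, X) ^ c)` for `X ∼ P`, an element of `[0, ∞]`; here `d` is the distance of the
space `E`. -/
def distMoment {E : Type*} [MeasurableSpace E] (d : E → E → ℝ) (c : ℕ) (P : Measure E)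
    (x : E) : ENNReal :=
  ∫⁻ y, ENNReal.ofReal (d x y ^ c) ∂P

/-- The Fréchet mean set `E₂ P`: the minimizers of `x ↦ E (d(x, X) ^ 2)`. -/
def frechetMean {E : Type*} [MeasurableSpace E] (d : E → E → ℝ) (P : Measure E) : Set E :=
  {x | ∀ y, distMoment d 2 P x ≤ distMoment d 2 P y}

/-- The Fréchet variance `V₂ P`. -/
def frechetVariance {E : Type*} [MeasurableSpace E] (d : E → E → ℝ) (P : Measure E) : ENNReal :=
  ⨅ x, distMoment d 2 P x

/-- The product `𝓧⁽ⁿ⁾` of the first `n` spaces (with the product `σ`-algebra). -/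
abbrev ProdSpace (𝓧 : ℕ → Type*) (n : ℕ) : Type _ := (i : Fin n) → 𝓧 i

/-- The distance `d(x, y) = ((1/n) ∑ i, d_i(x_i, y_i) ^ 2) ^ (1/2)` of `𝓧⁽ⁿ⁾`. -/
def prodDist {𝓧 : ℕ → Type*} [∀ i, MetricSpace (𝓧 i)] {n : ℕ} (x y : ProdSpace 𝓧 n) : ℝ :=
  Real.sqrt ((∑ i, dist (x i) (y i) ^ 2) / n)

/-- The point `[x, y]_t` on the geodesic of `𝓧⁽ⁿ⁾`; geodesics of the product are the pointwise
geodesics. -/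
def prodGeodesicPoint {𝓧 : ℕ → Type*} [∀ i, MetricSpace (𝓧 i)] [∀ i, HadamardSpace (𝓧 i)]
    {n : ℕ} (x y : ProdSpace 𝓧 n) (t : ℝ) : ProdSpace 𝓧 n :=
  fun i => geodesicPoint (x i) (y i) t

/-- The shrinkage weight `w(x) = 1 ∧ (σ² / d(x, ψ)²)`. (If `d(x, ψ) = 0` then `x = ψ`, and the
value of the weight does not affect the point `[x, ψ]_w`.) -/
def shrinkWeight {𝓧 : ℕ → Type*} [∀ i, MetricSpace (𝓧 i)] {n : ℕ} (σ : ℝ)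
    (ψ x : ProdSpace 𝓧 n) : ℝ :=
  min 1 (σ ^ 2 / prodDist x ψ ^ 2)

/-- The geodesic James–Stein estimator `δ_JS(x) = [x, ψ]_{w(x)}` with shrinkage point `ψ`. -/
def deltaJS {𝓧 : ℕ → Type*} [∀ i, MetricSpace (𝓧 i)] [∀ i, HadamardSpace (𝓧 i)] {n : ℕ}
    (σ : ℝ) (ψ x : ProdSpace 𝓧 n) : ProdSpace 𝓧 n :=
  prodGeodesicPoint x ψ (shrinkWeight σ ψ x)

/-- The loss `L(θ, a) = d(θ, a) ^ 2`. -/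
def loss {𝓧 : ℕ → Type*} [∀ i, MetricSpace (𝓧 i)] {n : ℕ} (θ a : ProdSpace 𝓧 n) : ℝ :=
  prodDist θ a ^ 2

/-- The risk `R(P, δ) = E [L(θ, δ(X))]` for `X ∼ P`, an element of `[0, ∞]`; here `θ` is the
estimand, i.e. the Fréchet mean of `P`. -/
def risk {𝓧 : ℕ → Type*} [∀ i, MetricSpace (𝓧 i)] [∀ i, MeasurableSpace (𝓧 i)] {n : ℕ}
    (P : Measure (ProdSpace 𝓧 n)) (θ : ProdSpace 𝓧 n)
    (δ : ProdSpace 𝓧 n → ProdSpace 𝓧 n) : ENNReal :=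
  ∫⁻ x, ENNReal.ofReal (loss θ (δ x)) ∂P

/-- The family `𝓟_m⁽ⁿ⁾` of product distributions on `𝓧⁽ⁿ⁾` with Fréchet variance `σ²` whose
marginals have positive central moments bounded by the sequence `m₁, m₂, …`. (In a Hadamard
space `frechetMean` of a law with finite Fréchet variance has exactly one element.) -/
def momentFamily (𝓧 : ℕ → Type*) [∀ i, MetricSpace (𝓧 i)] [∀ i, MeasurableSpace (𝓧 i)]
    (σ : ℝ) (m : ℕ → ℝ) (n : ℕ) : Set (Measure (ProdSpace 𝓧 n)) :=
  {P | ∃ Q : (i : Fin n) → Measure (𝓧 i), (∀ i, IsProbabilityMeasure (Q i)) ∧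
    P = Measure.pi Q ∧
    frechetVariance prodDist P = ENNReal.ofReal (σ ^ 2) ∧
    ∀ i, ∀ μ ∈ frechetMean dist (Q i), ∀ c : ℕ, 1 ≤ c →
      0 < distMoment dist c (Q i) μ ∧ distMoment dist c (Q i) μ ≤ ENNReal.ofReal (m c)}

end

open ProbabilityTheory ENNReal

/-! Write s = σ², S = d(θ, X)², D = d(ψ, X)², r = d(θ, ψ)², M = E D. The CAT(0) inequality bounds
the James–Stein loss by (1 - w) S + w r - w (1 - w) D, and the variance inequality for Fréchet means
gives r + s ≤ M. If S and D equalled their means s and M, these two facts would already make the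
loss at most s.

The fluctuations are controlled by independence: S has variance O(1/n), but the variance of D is
O((r + 1)/n), with no bound on r. The weight compensates: w (r + s) ≤ s + |D - M|, so only (D - M)²
/ (r + s) enters, and its mean is O(1/n) uniformly in ψ (`integral_sq_sub_integral_div_le`). Hence
the loss is at most s + 3η + G with E G = O(1/n) for fixed η; integration gives the risk bound and
Markov's inequality the bound in probability.

For the lower bound when r → ∞, the estimator moves X by w √D, and w² D ≤ s w is small on average;
by the triangle inequality the risk is then asymptotically at least E S = s. -/

/-! ### Scalar inequalities for the shrinkage weight. -/

theorem shrink_weight_le {s D r M w : ℝ} (hs : 0 < s) (hD : 0 ≤ D)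
    (hM : r + s ≤ M) (hw : w = min 1 (s / D)) :
    0 ≤ w ∧ w ≤ 1 ∧ w * D ≤ s ∧ w * (r + s) ≤ s + |D - M| ∧
      (∀ S, 0 ≤ S → (1 - w) * S + w * r - w * (1 - w) * D ≤ S + |S - s| + w * |D - M|) := by
  have he := neg_abs_le (D - M)
  have he0 := abs_nonneg (D - M)
  rcases hD.eq_or_lt with h0 | h0
  -- Here `s / 0 = 0`, so the weight is 0 rather than 1.
  · have : w = 0 := by rw [hw, ← h0]; simp
    subst this
    refine ⟨le_rfl, zero_le_one, by linarith, by linarith, fun S _ => ?_⟩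
    have := abs_nonneg (S - s)
    linarith
  rcases le_total D s with h | h
  · have : w = 1 := by rw [hw, min_eq_left]; rwa [one_le_div h0]
    subst this
    refine ⟨zero_le_one, le_rfl, by linarith, by linarith, fun S _ => ?_⟩
    have := abs_nonneg (S - s)
    linarith
  · have h1 : s / D ≤ 1 := by rwa [div_le_one h0]
    have hw' : w = s / D := by rw [hw, min_eq_right h1]
    have hwD : w * D = s := by rw [hw']; field_simp
    have hw0 : 0 ≤ w := by rw [hw']; positivity
    have hw1 : w ≤ 1 := hw' ▸ h1
    refine ⟨hw0, hw1, hwD.le, ?_, fun S _ => ?_⟩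
    · nlinarith [mul_le_mul_of_nonneg_left (show r + s ≤ D + |D - M| by linarith) hw0,
        mul_le_mul_of_nonneg_right hw1 he0]
    · have h2 := neg_abs_le (S - s)
      have h3 := abs_nonneg (S - s)
      have h4 : (1 - w) * S + w * r - w * (1 - w) * D = S - w * (S - r + D - w * D) := by ring
      rw [h4, hwD]
      nlinarith [mul_le_mul_of_nonneg_left
        (show -|S - s| - |D - M| ≤ S - r + D - s by linarith) hw0,
        mul_le_mul_of_nonneg_right hw1 h3]

theorem abs_le_add_sq_div {a η : ℝ} (hη : 0 < η) : |a| ≤ η + a ^ 2 / (4 * η) := by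
  rw [← sq_abs a, ← sub_nonneg]
  have : η + |a| ^ 2 / (4 * η) - |a| = (2 * η - |a|) ^ 2 / (4 * η) := by field_simp; ring
  rw [this]; positivity

/-- Young's inequality trades the absolute deviations for squares, whose means are variances. Two of
the η come from 2|S - s|, the third from w |D - M|. -/
theorem shrink_loss_le {s D r M w S η : ℝ} (hs : 0 < s) (hD : 0 ≤ D)
    (hM : r + s ≤ M) (hr : 0 ≤ r) (hw : w = min 1 (s / D)) (hS : 0 ≤ S) (hη : 0 < η) :
    (1 - w) * S + w * r - w * (1 - w) * D ≤
      s + 3 * η + ((S - s) ^ 2 / (2 * η) + (1 + s / (4 * η)) * ((D - M) ^ 2 / (r + s))) := by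
  obtain ⟨hw0, hw1, -, hw2, h⟩ := shrink_weight_le hs hD hM hw
  refine (h S hS).trans ?_
  have h1 := abs_le_add_sq_div (a := S - s) hη
  have h2 := abs_le_add_sq_div (a := D - M) hη
  have h3 := le_abs_self (S - s)
  have e1 : (S - s) ^ 2 / (2 * η) = 2 * ((S - s) ^ 2 / (4 * η)) := by field_simp; norm_num
  have hrs : 0 < r + s := by linarith
  have h4 : w * |D - M| ≤ η + (1 + s / (4 * η)) * ((D - M) ^ 2 / (r + s)) := by
    have e2 : η + (1 + s / (4 * η)) * ((D - M) ^ 2 / (r + s)) =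
        (η * (r + s) + (1 + s / (4 * η)) * (D - M) ^ 2) / (r + s) := by field_simp
    rw [e2, le_div_iff₀ hrs]
    have h5 := mul_le_mul_of_nonneg_right hw2 (abs_nonneg (D - M))
    have h6 := mul_le_mul_of_nonneg_left h2 hs.le
    have h7 := mul_nonneg hη.le hr
    have e3 : (1 + s / (4 * η)) * (D - M) ^ 2 = (D - M) ^ 2 + s * ((D - M) ^ 2 / (4 * η)) := by
      field_simp
    rw [e3]
    nlinarith [sq_abs (D - M)]
  linarith

theorem shrink_sq_mul_le {s D r M w : ℝ} (hs : 0 < s) (hD : 0 ≤ D)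
    (hM : r + s ≤ M) (hr : 0 ≤ r) (hw : w = min 1 (s / D)) :
    w ^ 2 * D ≤ s * ((s + 1) / (r + s) + (D - M) ^ 2 / (r + s)) := by
  obtain ⟨hw0, hw1, hw3, hw2, -⟩ := shrink_weight_le hs hD hM hw
  have hrs : 0 < r + s := by linarith
  -- From w (r + s) ≤ s + |D - M| and |D - M| ≤ 1 + (D - M)².
  have h1 : w ≤ (s + 1) / (r + s) + (D - M) ^ 2 / (r + s) := by
    rw [← add_div, le_div_iff₀ hrs]
    nlinarith [sq_nonneg (|D - M| - 1), sq_abs (D - M), sq_nonneg |D - M|]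
  calc w ^ 2 * D = w * (w * D) := by ring
    _ ≤ w * s := by gcongr
    _ = s * w := mul_comm _ _
    _ ≤ _ := by gcongr

theorem geodesicPoint_isGeodesic {E : Type*} [MetricSpace E] [HadamardSpace E] (x y : E) :
    IsGeodesicFromTo x y (geodesicPoint x y) :=
  Classical.choose_spec (HadamardSpace.exists_geodesic x y)

theorem dist_geodesicPoint {E : Type*} [MetricSpace E] [HadamardSpace E] (x y : E) {t : ℝ}
    (h0 : 0 ≤ t) (h1 : t ≤ 1) : dist x (geodesicPoint x y t) = t * dist x y := by
  have h := geodesicPoint_isGeodesic x y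
  have := h.2.2 0 (by simp) t ⟨h0, h1⟩
  rw [h.1] at this
  rw [this, zero_sub, abs_neg, abs_of_nonneg h0, mul_comm]

theorem dist_sq_le_two_mul {E : Type*} [MetricSpace E] (z μ x : E) : dist z x ^ 2 ≤ 2 * dist z μ ^ 2 + 2 * dist μ x ^ 2 := by
  nlinarith [dist_triangle z μ x, sq_nonneg (dist z μ - dist μ x),
    dist_nonneg (x := z) (y := x)]

/-! ### One factor: variance inequality and moments of squared distances. -/

section Coordinate

variable {E : Type*} [MetricSpace E] [MeasurableSpace E] {Q : Measure E} [IsProbabilityMeasure Q]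

/-- The variance inequality for the Fréchet mean in a Hadamard space. -/
theorem dist_sq_add_integral_le [HadamardSpace E] {μ : E} (hμ : μ ∈ frechetMean dist Q)
    (hint : ∀ z, Integrable (fun x => dist z x ^ 2) Q) (z : E) :
    dist μ z ^ 2 + ∫ x, dist μ x ^ 2 ∂Q ≤ ∫ x, dist z x ^ 2 ∂Q := by
  -- Compare μ with the point at time t on the geodesic to z: minimality and the integrated CAT(0)
  -- inequality give this after division by t. Then let t → 0.
  have key : ∀ t ∈ Set.Ioc (0 : ℝ) 1,
      (1 - t) * dist μ z ^ 2 + ∫ x, dist μ x ^ 2 ∂Q ≤ ∫ x, dist z x ^ 2 ∂Q := by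
    rintro t ⟨h0, h1⟩
    have hmin : ∫ x, dist μ x ^ 2 ∂Q ≤ ∫ x, dist (geodesicPoint μ z t) x ^ 2 ∂Q := by
      have := hμ (geodesicPoint μ z t)
      unfold distMoment at this
      rwa [← ofReal_integral_eq_lintegral_ofReal (hint _) (ae_of_all _ fun x => by positivity),
        ← ofReal_integral_eq_lintegral_ofReal (hint _) (ae_of_all _ fun x => by positivity),
        ENNReal.ofReal_le_ofReal_iff (integral_nonneg fun x => by positivity)] at this
    have hsum : Integrable (fun x => (1 - t) * dist μ x ^ 2 + t * dist z x ^ 2) Q :=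
      ((hint μ).const_mul _).add ((hint z).const_mul _)
    have hcat : ∫ x, dist (geodesicPoint μ z t) x ^ 2 ∂Q ≤
        ∫ x, ((1 - t) * dist μ x ^ 2 + t * dist z x ^ 2 - t * (1 - t) * dist μ z ^ 2) ∂Q :=
      integral_mono (hint _)
        (hsum.sub (integrable_const _))
        fun x => HadamardSpace.cat0 μ z x _ (geodesicPoint_isGeodesic μ z) t ⟨h0.le, h1⟩
    rw [integral_sub hsum (integrable_const _),
      integral_add ((hint μ).const_mul _) ((hint z).const_mul _), integral_const_mul,
      integral_const_mul, integral_const] at hcat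
    simp only [probReal_univ, one_smul] at hcat
    have := hmin.trans hcat
    refine le_of_mul_le_mul_left ?_ h0
    linarith
  have hlim : Tendsto (fun t : ℝ => (1 - t) * dist μ z ^ 2 + ∫ x, dist μ x ^ 2 ∂Q) (𝓝[>] 0)
      (𝓝 ((1 - 0) * dist μ z ^ 2 + ∫ x, dist μ x ^ 2 ∂Q)) := by
    apply Tendsto.mono_left _ nhdsWithin_le_nhds
    exact Continuous.tendsto (by fun_prop) 0
  rw [sub_zero, one_mul] at hlim
  exact le_of_tendsto hlim (by filter_upwards [Ioc_mem_nhdsGT one_pos] with t ht using key t ht)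

variable [BorelSpace E]

theorem measurable_dist_const_left (z : E) : Measurable (fun x : E => dist z x) :=
  (continuous_const.dist continuous_id).measurable

theorem integrable_dist_pow {Q : Measure E} {c : ℕ} {μ : E} {a : ℝ}
    (h : distMoment dist c Q μ ≤ ENNReal.ofReal a) : Integrable (fun x => dist μ x ^ c) Q := by
  refine ⟨((measurable_dist_const_left μ).pow_const c).aestronglyMeasurable, ?_⟩
  rw [hasFiniteIntegral_iff_ofReal (ae_of_all _ fun x => by positivity)]
  exact h.trans_lt ofReal_lt_top

theorem integral_dist_pow_le {Q : Measure E} {c : ℕ} {μ : E} {a : ℝ} (ha : 0 ≤ a)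
    (h : distMoment dist c Q μ ≤ ENNReal.ofReal a) : ∫ x, dist μ x ^ c ∂Q ≤ a := by
  rw [← ENNReal.ofReal_le_ofReal_iff ha, ofReal_integral_eq_lintegral_ofReal
    (integrable_dist_pow h) (ae_of_all _ fun x => by positivity)]
  exact h

theorem memLp_dist_sq {μ : E} {a : ℝ} (h : distMoment dist 4 Q μ ≤ ENNReal.ofReal a) (z : E) :
    MemLp (fun x => dist z x ^ 2) 2 Q := by
  have h0 : MemLp (fun x => dist μ x ^ 2) 2 Q := by
    rw [memLp_two_iff_integrable_sq
      ((measurable_dist_const_left μ).pow_const 2).aestronglyMeasurable]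
    simpa only [← pow_mul] using integrable_dist_pow h
  have h1 : MemLp (fun x => 2 * dist z μ ^ 2 + 2 * dist μ x ^ 2) 2 Q :=
    MemLp.add (memLp_const _) (h0.const_mul 2)
  refine h1.mono
    ((measurable_dist_const_left z).pow_const 2).aestronglyMeasurable (ae_of_all _ fun x => ?_)
  rw [Real.norm_eq_abs, Real.norm_eq_abs, abs_of_nonneg (by positivity), abs_of_nonneg (by positivity)]
  exact dist_sq_le_two_mul z μ x

/-- The variance is at most the second moment about the constant d(μ, z)², and by the triangle
inequality d(z, x)² deviates from it by at most y (2r + y), where r = d(μ, z), y = d(μ, x). The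
essential point is growth of order r², not r⁴. -/
theorem variance_dist_sq_le {μ : E} {a b : ℝ} (ha : 0 ≤ a) (hb : 0 ≤ b)
    (h2 : distMoment dist 2 Q μ ≤ ENNReal.ofReal a)
    (h4 : distMoment dist 4 Q μ ≤ ENNReal.ofReal b) (z : E) :
    Var[fun x => dist z x ^ 2; Q] ≤ 8 * a * dist μ z ^ 2 + 2 * b := by
  have hm := memLp_dist_sq h4 z
  rw [← variance_sub_const hm.aestronglyMeasurable (dist μ z ^ 2)]
  refine (variance_le_expectation_sq
    (hm.aestronglyMeasurable.sub aestronglyMeasurable_const)).trans ?_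
  have i2 := integrable_dist_pow h2
  have i4 := integrable_dist_pow h4
  calc ∫ x, ((fun x => dist z x ^ 2 - dist μ z ^ 2) ^ 2) x ∂Q
      ≤ ∫ x, (8 * dist μ z ^ 2 * dist μ x ^ 2 + 2 * dist μ x ^ 4) ∂Q := by
        refine integral_mono_of_nonneg (ae_of_all _ fun x => by simp; positivity)
          ((i2.const_mul _).add (i4.const_mul _)) (ae_of_all _ fun x => ?_)
        simp only [Pi.pow_apply]
        have t1 := dist_triangle z μ x
        have t2 := dist_triangle_right μ z x
        have e : dist z μ = dist μ z := dist_comm _ _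
        have e0 := dist_nonneg (x := μ) (y := z)
        have e1 := dist_nonneg (x := μ) (y := x)
        have e2 := dist_nonneg (x := z) (y := x)
        have t3 : dist μ z ≤ dist z x + dist μ x := by linarith
        generalize dist μ z = r at *
        generalize dist z x = d at *
        generalize dist μ x = y at *
        have hab : |d ^ 2 - r ^ 2| ≤ y * (2 * r + y) := by
          rw [abs_le]
          constructor
          · rcases le_total y r with h | h <;> nlinarith
          · nlinarith
        rw [← sq_abs (d ^ 2 - r ^ 2)]
        calc |d ^ 2 - r ^ 2| ^ 2 ≤ (y * (2 * r + y)) ^ 2 := by gcongr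
          _ ≤ _ := by nlinarith [sq_nonneg (y * (2 * r - y))]
    _ = 8 * dist μ z ^ 2 * ∫ x, dist μ x ^ 2 ∂Q + 2 * ∫ x, dist μ x ^ 4 ∂Q := by
        rw [integral_add (i2.const_mul _) (i4.const_mul _), integral_const_mul,
          integral_const_mul]
    _ ≤ 8 * dist μ z ^ 2 * a + 2 * b := by
        gcongr
        · exact integral_dist_pow_le ha h2
        · exact integral_dist_pow_le hb h4
    _ = _ := by ring

end Coordinate

/-! ### Product space: averages of independent coordinates. -/

section Product

variable {𝓧 : ℕ → Type*} [∀ i, MetricSpace (𝓧 i)] {n : ℕ}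

theorem prodDist_sq (x y : ProdSpace 𝓧 n) :
    prodDist x y ^ 2 = (∑ i, dist (x i) (y i) ^ 2) / n :=
  Real.sq_sqrt (by positivity)

theorem prodDist_comm (x y : ProdSpace 𝓧 n) : prodDist x y = prodDist y x := by
  simp only [prodDist, dist_comm]

variable [∀ i, MeasurableSpace (𝓧 i)] {Q : (i : Fin n) → Measure (𝓧 i)}
  [∀ i, IsProbabilityMeasure (Q i)]

theorem memLp_dist_sq_eval
    (hmem : ∀ (i : Fin n) (z : 𝓧 i), MemLp (fun x => dist z x ^ 2) 2 (Q i))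
    (z : ProdSpace 𝓧 n) (i : Fin n) :
    MemLp (fun x : ProdSpace 𝓧 n => dist (z i) (x i) ^ 2) 2 (Measure.pi Q) :=
  (hmem i (z i)).comp_measurePreserving (measurePreserving_eval Q i)

theorem memLp_prodDist_sq
    (hmem : ∀ (i : Fin n) (z : 𝓧 i), MemLp (fun x => dist z x ^ 2) 2 (Q i))
    (z : ProdSpace 𝓧 n) :
    MemLp (fun x => prodDist z x ^ 2) 2 (Measure.pi Q) := by
  simp only [prodDist_sq, div_eq_inv_mul]
  exact (memLp_finsetSum _ fun i _ => memLp_dist_sq_eval hmem z i).const_mul _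

variable [∀ i, BorelSpace (𝓧 i)]

theorem distMoment_prodDist (hn : 1 ≤ n) (x : ProdSpace 𝓧 n) :
    distMoment prodDist 2 (Measure.pi Q) x =
      (∑ i, distMoment dist 2 (Q i) (x i)) * (n : ℝ≥0∞)⁻¹ := by
  have hn' : (n : ℝ≥0∞)⁻¹ ≠ ∞ := by simp; omega
  have hm : ∀ i : Fin n, Measurable fun y : 𝓧 i => ENNReal.ofReal (dist (x i) y ^ 2) := fun i =>
    ((measurable_dist_const_left (x i)).pow_const 2).ennreal_ofReal
  have h : ∀ y : ProdSpace 𝓧 n, ENNReal.ofReal (prodDist x y ^ 2) =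
      (∑ i, ENNReal.ofReal (dist (x i) (y i) ^ 2)) * (n : ℝ≥0∞)⁻¹ := fun y => by
    rw [prodDist_sq, ENNReal.ofReal_div_of_pos (by positivity),
      ENNReal.ofReal_sum_of_nonneg (fun i _ => by positivity), ENNReal.ofReal_natCast,
      ENNReal.div_eq_inv_mul, mul_comm]
  simp only [distMoment, h]
  rw [lintegral_mul_const' _ _ hn',
    lintegral_finsetSum (f := fun i (y : ProdSpace 𝓧 n) => ENNReal.ofReal (dist (x i) (y i) ^ 2)) _
      fun i _ => (hm i).comp (measurable_pi_apply i)]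
  congr 1
  exact Finset.sum_congr rfl fun i _ => (measurePreserving_eval Q i).lintegral_comp (hm i)

theorem frechetVariance_eq {E : Type*} [MeasurableSpace E] {d : E → E → ℝ} {P : Measure E}
    {x : E} (hx : x ∈ frechetMean d P) : frechetVariance d P = distMoment d 2 P x :=
  le_antisymm (iInf_le _ x) (le_iInf hx)

/-- The product objective is a multiple of the sum of the coordinate objectives, so changing one
coordinate isolates its term. Finiteness permits cancelling the others. This makes the marginal
moment bounds available at the coordinates of θ. -/
theorem mem_frechetMean_of_prod (hn : 1 ≤ n) {θ : ProdSpace 𝓧 n}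
    (hθ : θ ∈ frechetMean prodDist (Measure.pi Q))
    (hfin : distMoment prodDist 2 (Measure.pi Q) θ ≠ ∞) (i : Fin n) :
    θ i ∈ frechetMean dist (Q i) := by
  intro y
  have hn0 : (n : ℝ≥0∞)⁻¹ ≠ 0 := by simp
  have hn' : (n : ℝ≥0∞)⁻¹ ≠ ∞ := by simp; omega
  have h := hθ (Function.update θ i y)
  rw [distMoment_prodDist hn, distMoment_prodDist hn, ENNReal.mul_le_mul_iff_left hn0 hn',
    ← Finset.add_sum_erase _ _ (Finset.mem_univ i),
    ← Finset.add_sum_erase (a := i) _ (fun j => distMoment dist 2 (Q j) (Function.update θ i y j))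
      (Finset.mem_univ i), Function.update_self,
    Finset.sum_congr (f := fun j => distMoment dist 2 (Q j) (Function.update θ i y j))
      (g := fun j => distMoment dist 2 (Q j) (θ j)) rfl fun j hj => by
      rw [Function.update_of_ne (Finset.ne_of_mem_erase hj)]] at h
  rw [distMoment_prodDist hn] at hfin
  refine (ENNReal.add_le_add_iff_right ?_).1 h
  intro htop
  apply hfin
  rw [← Finset.add_sum_erase _ _ (Finset.mem_univ i), htop, add_top, ENNReal.top_mul hn0]

theorem integral_prodDist_sq
    (hmem : ∀ (i : Fin n) (z : 𝓧 i), MemLp (fun x => dist z x ^ 2) 2 (Q i))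
    (z : ProdSpace 𝓧 n) :
    ∫ x, prodDist z x ^ 2 ∂(Measure.pi Q) = (∑ i, ∫ x, dist (z i) x ^ 2 ∂(Q i)) / n := by
  simp only [prodDist_sq]
  rw [integral_div, integral_finsetSum _ fun i _ =>
    (memLp_dist_sq_eval hmem z i).integrable (by norm_num)]
  congr 1
  refine Finset.sum_congr rfl fun i _ => ?_
  rw [← (measurePreserving_eval Q i).map_eq, integral_map (measurable_pi_apply i).aemeasurable
    ((measurable_dist_const_left (z i)).pow_const 2).aestronglyMeasurable]

theorem variance_prodDist_sq
    (hmem : ∀ (i : Fin n) (z : 𝓧 i), MemLp (fun x => dist z x ^ 2) 2 (Q i))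
    (z : ProdSpace 𝓧 n) :
    Var[fun x => prodDist z x ^ 2; Measure.pi Q] =
      (∑ i, Var[fun x => dist (z i) x ^ 2; Q i]) / n ^ 2 := by
  have hm : ∀ i : Fin n, Measurable fun y : 𝓧 i => dist (z i) y ^ 2 := fun i =>
    (measurable_dist_const_left (z i)).pow_const 2
  have hind : iIndepFun (fun i (x : ProdSpace 𝓧 n) => dist (z i) (x i) ^ 2) (Measure.pi Q) :=
    iIndepFun_pi fun i => (hm i).aemeasurable
  simp only [prodDist_sq, div_eq_inv_mul]
  rw [variance_const_mul]
  have h := IndepFun.variance_sum (s := Finset.univ)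
    (fun i _ => memLp_dist_sq_eval hmem z i) fun i _ j _ hij => hind.indepFun hij
  have e : (∑ i, fun x : ProdSpace 𝓧 n => dist (z i) (x i) ^ 2) =
      fun x => ∑ i, dist (z i) (x i) ^ 2 := by ext; simp
  rw [e] at h
  rw [h, inv_pow]
  congr 1
  refine Finset.sum_congr rfl fun i _ => ?_
  rw [← (measurePreserving_eval Q i).map_eq, variance_map (hm i).aemeasurable
    (measurable_pi_apply i).aemeasurable]
  rfl

end Product

/-- Moment bounds for `x ↦ d(z, x)²` under a member of the moment family. -/
theorem momentFamily_bounds {𝓧 : ℕ → Type*} [∀ i, MetricSpace (𝓧 i)] [∀ i, HadamardSpace (𝓧 i)]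
    [∀ i, MeasurableSpace (𝓧 i)] [∀ i, BorelSpace (𝓧 i)] {n : ℕ} (hn : 1 ≤ n) {σ : ℝ} {m : ℕ → ℝ}
    {P : Measure (ProdSpace 𝓧 n)} (hP : P ∈ momentFamily 𝓧 σ m n) {θ : ProdSpace 𝓧 n}
    (hθ : θ ∈ frechetMean prodDist P) :
    IsProbabilityMeasure P ∧ 0 < σ ^ 2 ∧ 0 ≤ m 2 ∧ 0 ≤ m 4 ∧
      (∀ z, MemLp (fun x => prodDist z x ^ 2) 2 P) ∧
      ∫ x, prodDist θ x ^ 2 ∂P = σ ^ 2 ∧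
      ∀ z, prodDist θ z ^ 2 + σ ^ 2 ≤ ∫ x, prodDist z x ^ 2 ∂P ∧
        Var[fun x => prodDist z x ^ 2; P] ≤ (8 * m 2 * prodDist θ z ^ 2 + 2 * m 4) / n := by
  obtain ⟨Q, hQ, rfl, hV, hc⟩ := hP
  rw [frechetVariance_eq hθ] at hV
  have hmean := mem_frechetMean_of_prod hn hθ (hV ▸ ENNReal.ofReal_ne_top)
  have hn0 : (0 : ℝ) < n := by exact_mod_cast hn
  have hmom i c (h : 1 ≤ c) := hc i _ (hmean i) c h
  have hm c (h : 1 ≤ c) : 0 ≤ m c := by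
    obtain ⟨h1, h2⟩ := hmom ⟨0, hn⟩ c h
    exact (ENNReal.ofReal_pos.1 (h1.trans_le h2)).le
  have hmem : ∀ (i : Fin n) (z : 𝓧 i), MemLp (fun x => dist z x ^ 2) 2 (Q i) := fun i z =>
    memLp_dist_sq (hmom i 4 (by norm_num)).2 z
  -- Positivity of σ² comes from the positive second central moment of a coordinate.
  have hs : 0 < σ ^ 2 := by
    rw [← ENNReal.ofReal_pos, ← hV, distMoment_prodDist hn]
    refine ENNReal.mul_pos (ne_of_gt ?_) (by simp)
    exact (hmom ⟨0, hn⟩ 2 (by norm_num)).1.trans_le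
      (Finset.single_le_sum (f := fun i => distMoment dist 2 (Q i) (θ i))
        (fun i _ => zero_le) (Finset.mem_univ _))
  have hE : ∫ x, prodDist θ x ^ 2 ∂(Measure.pi Q) = σ ^ 2 := by
    have h : ENNReal.ofReal (∫ x, prodDist θ x ^ 2 ∂(Measure.pi Q)) = ENNReal.ofReal (σ ^ 2) := by
      rw [← hV, ofReal_integral_eq_lintegral_ofReal
        ((memLp_prodDist_sq hmem θ).integrable (by norm_num))
        (ae_of_all _ fun x => by positivity)]
      rfl
    rwa [ENNReal.ofReal_eq_ofReal_iff (integral_nonneg fun x => by positivity) hs.le] at h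
  refine ⟨inferInstance, hs, hm 2 (by norm_num), hm 4 (by norm_num), memLp_prodDist_sq hmem, hE,
    fun z => ⟨?_, ?_⟩⟩
  · rw [← hE, integral_prodDist_sq hmem, integral_prodDist_sq hmem, prodDist_sq, ← add_div,
      ← Finset.sum_add_distrib]
    gcongr with i
    exact dist_sq_add_integral_le (hmean i) (fun z => (hmem i z).integrable (by norm_num)) (z i)
  · rw [variance_prodDist_sq hmem, div_le_div_iff₀ (by positivity) hn0]
    have h : ∑ i, Var[fun x => dist (z i) x ^ 2; Q i] ≤
        ∑ i, (8 * m 2 * dist (θ i) (z i) ^ 2 + 2 * m 4) :=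
      Finset.sum_le_sum fun i _ => variance_dist_sq_le (hm 2 (by norm_num)) (hm 4 (by norm_num))
        (hmom i 2 (by norm_num)).2 (hmom i 4 (by norm_num)).2 (z i)
    rw [Finset.sum_add_distrib, ← Finset.mul_sum, Finset.sum_const, Finset.card_univ,
      Fintype.card_fin, nsmul_eq_mul] at h
    have e : ∑ i, dist (θ i) (z i) ^ 2 = n * prodDist θ z ^ 2 := by
      rw [prodDist_sq]; field_simp
    rw [e] at h
    calc _ ≤ (8 * m 2 * (n * prodDist θ z ^ 2) + n * (2 * m 4)) * n := by gcongr
      _ = _ := by ring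

/-! ### Pointwise and mean bounds for the James–Stein loss. -/

section Loss

variable {𝓧 : ℕ → Type*} [∀ i, MetricSpace (𝓧 i)] {n : ℕ}

theorem shrinkWeight_eq (σ : ℝ) (ψ x : ProdSpace 𝓧 n) :
    shrinkWeight σ ψ x = min 1 (σ ^ 2 / prodDist ψ x ^ 2) := by
  rw [shrinkWeight, prodDist_comm]

theorem shrinkWeight_nonneg (σ : ℝ) (ψ x : ProdSpace 𝓧 n) : 0 ≤ shrinkWeight σ ψ x :=
  le_min zero_le_one (by positivity)

theorem shrinkWeight_le_one (σ : ℝ) (ψ x : ProdSpace 𝓧 n) : shrinkWeight σ ψ x ≤ 1 :=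
  min_le_left _ _

variable [∀ i, HadamardSpace (𝓧 i)]

theorem loss_deltaJS_le (σ : ℝ) (θ ψ x : ProdSpace 𝓧 n) :
    loss θ (deltaJS σ ψ x) ≤ (1 - shrinkWeight σ ψ x) * prodDist θ x ^ 2 +
      shrinkWeight σ ψ x * prodDist θ ψ ^ 2 -
        shrinkWeight σ ψ x * (1 - shrinkWeight σ ψ x) * prodDist ψ x ^ 2 := by
  simp only [loss, prodDist_sq]
  rw [← mul_div_assoc, ← mul_div_assoc, ← mul_div_assoc, ← add_div, ← sub_div, Finset.mul_sum,
    Finset.mul_sum, Finset.mul_sum, ← Finset.sum_add_distrib, ← Finset.sum_sub_distrib]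
  gcongr with i
  have h := HadamardSpace.cat0 (x i) (ψ i) (θ i) _ (geodesicPoint_isGeodesic (x i) (ψ i))
    (shrinkWeight σ ψ x) ⟨shrinkWeight_nonneg σ ψ x, shrinkWeight_le_one σ ψ x⟩
  simp only [dist_comm (x i), dist_comm (ψ i) (θ i), dist_comm _ (θ i)] at h
  exact h

/-- The η-term carries y rather than a because in the application y = d(θ, X)_i, whose averaged
square has known mean σ², while a is a distance to the estimator. -/
theorem sq_le_sq_add_of_le_add {a b y η : ℝ} (ha : 0 ≤ a) (hb : 0 ≤ b) (hy : 0 ≤ y) (hη : 0 < η)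
    (h : y ≤ a + b) : y ^ 2 ≤ a ^ 2 + 2 * η * y ^ 2 + b ^ 2 / (2 * η) := by
  have h1 : y ^ 2 ≤ a ^ 2 + 2 * (y * b) := by
    rcases le_total y b with h' | h' <;> nlinarith
  have h2 : 2 * η * y ^ 2 + b ^ 2 / (2 * η) - 2 * (y * b) = (2 * η * y - b) ^ 2 / (2 * η) := by
    field_simp; ring
  have h3 : 0 ≤ (2 * η * y - b) ^ 2 / (2 * η) := by positivity
  linarith

theorem prodDist_sq_le_loss_deltaJS_add (σ : ℝ) (θ ψ x : ProdSpace 𝓧 n) {η : ℝ} (hη : 0 < η) :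
    prodDist θ x ^ 2 ≤ loss θ (deltaJS σ ψ x) + 2 * η * prodDist θ x ^ 2 +
      shrinkWeight σ ψ x ^ 2 * prodDist ψ x ^ 2 / (2 * η) := by
  have e : shrinkWeight σ ψ x ^ 2 * prodDist ψ x ^ 2 / (2 * η) =
      (∑ i, (shrinkWeight σ ψ x * dist (ψ i) (x i)) ^ 2 / (2 * η)) / n := by
    rw [prodDist_sq]
    simp only [mul_pow]
    rw [← Finset.sum_div, ← Finset.mul_sum]
    ring
  rw [e]
  simp only [loss, prodDist_sq]
  rw [← mul_div_assoc, ← add_div, ← add_div, Finset.mul_sum, ← Finset.sum_add_distrib,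
    ← Finset.sum_add_distrib]
  gcongr with i
  have hw := shrinkWeight_nonneg σ ψ x
  refine sq_le_sq_add_of_le_add dist_nonneg (by positivity) dist_nonneg hη ?_
  refine (dist_triangle_right _ _ (deltaJS σ ψ x i)).trans ?_
  have : dist (x i) (deltaJS σ ψ x i) = shrinkWeight σ ψ x * dist (x i) (ψ i) :=
    dist_geodesicPoint _ _ hw (shrinkWeight_le_one σ ψ x)
  rw [this, dist_comm (x i) (ψ i)]

variable [∀ i, MeasurableSpace (𝓧 i)] [∀ i, BorelSpace (𝓧 i)] {σ : ℝ} {m : ℕ → ℝ}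
  {P : Measure (ProdSpace 𝓧 n)} {θ : ProdSpace 𝓧 n}

theorem integrable_sq_sub_integral (hn : 1 ≤ n) (hP : P ∈ momentFamily 𝓧 σ m n)
    (hθ : θ ∈ frechetMean prodDist P) (z : ProdSpace 𝓧 n) :
    Integrable (fun x => (prodDist z x ^ 2 - ∫ y, prodDist z y ^ 2 ∂P) ^ 2) P := by
  obtain ⟨_, -, -, -, hmem, -⟩ := momentFamily_bounds hn hP hθ
  exact ((hmem z).sub (memLp_const _)).integrable_sq

theorem integral_sq_sub_integral_div_le (hn : 1 ≤ n) (hP : P ∈ momentFamily 𝓧 σ m n)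
    (hθ : θ ∈ frechetMean prodDist P) (z : ProdSpace 𝓧 n) :
    ∫ x, (prodDist z x ^ 2 - ∫ y, prodDist z y ^ 2 ∂P) ^ 2 / (prodDist θ z ^ 2 + σ ^ 2) ∂P ≤
      (8 * m 2 + 2 * m 4 / σ ^ 2) / n := by
  obtain ⟨_, hs, h2, h4, hmem, hE, hz⟩ := momentFamily_bounds hn hP hθ
  have hr := sq_nonneg (prodDist θ z)
  have hn0 : (0 : ℝ) < n := by exact_mod_cast hn
  rw [integral_div, ← variance_eq_integral (hmem z).aestronglyMeasurable.aemeasurable,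
    div_le_iff₀ (by linarith)]
  refine (hz z).2.trans ?_
  rw [div_mul_eq_mul_div]
  gcongr
  have e : 2 * m 4 / σ ^ 2 * σ ^ 2 = 2 * m 4 := div_mul_cancel₀ _ hs.ne'
  have : 0 ≤ 2 * m 4 / σ ^ 2 * prodDist θ z ^ 2 := by positivity
  nlinarith [mul_nonneg h2 hs.le]

/-- An integrable majorant serves both the risk bound and Markov's inequality, without measurability
of the loss. -/
theorem exists_integrable_loss_deltaJS_le (hn : 1 ≤ n) (hP : P ∈ momentFamily 𝓧 σ m n)
    (hθ : θ ∈ frechetMean prodDist P) (ψ : ProdSpace 𝓧 n) {η : ℝ} (hη : 0 < η) :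
    ∃ G : ProdSpace 𝓧 n → ℝ, Integrable G P ∧ 0 ≤ G ∧
      ∫ x, G x ∂P ≤ (m 4 / η +
        (1 + σ ^ 2 / (4 * η)) * (8 * m 2 + 2 * m 4 / σ ^ 2)) / n ∧
      ∀ x, loss θ (deltaJS σ ψ x) ≤ σ ^ 2 + 3 * η + G x := by
  obtain ⟨_, hs, -, -, hmem, hE, hz⟩ := momentFamily_bounds hn hP hθ
  have hn0 : (0 : ℝ) < n := by exact_mod_cast hn
  have i1 := (integrable_sq_sub_integral hn hP hθ θ).div_const (2 * η)
  have i2 := ((integrable_sq_sub_integral hn hP hθ ψ).div_const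
    (prodDist θ ψ ^ 2 + σ ^ 2)).const_mul (1 + σ ^ 2 / (4 * η))
  refine ⟨_, i1.add i2, fun x => ?_, ?_, fun x => ?_⟩
  · simp only [Pi.zero_apply, Pi.add_apply]
    positivity
  · simp only [Pi.add_apply]
    rw [integral_add i1 i2, integral_div, integral_const_mul, add_div, mul_div_assoc]
    refine add_le_add ?_
      (mul_le_mul_of_nonneg_left (integral_sq_sub_integral_div_le hn hP hθ ψ) (by positivity))
    rw [← variance_eq_integral (hmem θ).aestronglyMeasurable.aemeasurable,
      div_le_iff₀ (by positivity)]
    refine (hz θ).2.trans (le_of_eq ?_)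
    have : prodDist θ θ = 0 := by simp [prodDist]
    rw [this]
    field_simp
    ring
  · simp only [Pi.add_apply]
    rw [hE]
    exact (loss_deltaJS_le σ θ ψ x).trans (shrink_loss_le hs (by positivity) (hz ψ).1
      (by positivity) (shrinkWeight_eq σ ψ x) (by positivity) hη)

theorem exists_integrable_prodDist_sq_le (hn : 1 ≤ n) (hP : P ∈ momentFamily 𝓧 σ m n)
    (hθ : θ ∈ frechetMean prodDist P) (ψ : ProdSpace 𝓧 n) {η : ℝ} (hη : 0 < η) :
    ∃ H : ProdSpace 𝓧 n → ℝ, Integrable H P ∧ 0 ≤ H ∧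
      ∫ x, H x ∂P ≤ 2 * η * σ ^ 2 + σ ^ 2 / (2 * η) *
        ((σ ^ 2 + 1) / (prodDist θ ψ ^ 2 + σ ^ 2) + (8 * m 2 + 2 * m 4 / σ ^ 2) / n) ∧
      ∀ x, prodDist θ x ^ 2 ≤ loss θ (deltaJS σ ψ x) + H x := by
  obtain ⟨_, hs, -, -, hmem, hE, hz⟩ := momentFamily_bounds hn hP hθ
  have i1 := ((hmem θ).integrable (by norm_num)).const_mul (2 * η)
  have i2 := (integrable_sq_sub_integral hn hP hθ ψ).div_const (prodDist θ ψ ^ 2 + σ ^ 2)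
  have i3 := ((integrable_const (μ := P)
    ((σ ^ 2 + 1) / (prodDist θ ψ ^ 2 + σ ^ 2))).add i2).const_mul (σ ^ 2 / (2 * η))
  refine ⟨_, i1.add i3, fun x => ?_, ?_, fun x => ?_⟩
  · simp only [Pi.zero_apply, Pi.add_apply]
    positivity
  · simp only [Pi.add_apply] at i3 ⊢
    rw [integral_add i1 i3, integral_const_mul, integral_const_mul, hE,
      integral_add (integrable_const _) i2, integral_const]
    simp only [probReal_univ, one_smul]
    gcongr
    exact integral_sq_sub_integral_div_le hn hP hθ ψ
  · simp only [Pi.add_apply]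
    refine (prodDist_sq_le_loss_deltaJS_add σ θ ψ x hη).trans ?_
    rw [add_assoc]
    gcongr
    rw [div_mul_eq_mul_div]
    exact div_le_div_of_nonneg_right (shrink_sq_mul_le hs (by positivity) (hz ψ).1
      (by positivity) (shrinkWeight_eq σ ψ x)) (by positivity)

end Loss

/-! ### Passage to the limit. -/

theorem lintegral_ofReal_le_of_le_add {Ω : Type*} [MeasurableSpace Ω] {P : Measure Ω}
    {f g G : Ω → ℝ} (hG : Integrable G P) (hG0 : 0 ≤ G) (hfg : ∀ x, f x ≤ g x + G x) :
    ∫⁻ x, ENNReal.ofReal (f x) ∂P ≤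
      ∫⁻ x, ENNReal.ofReal (g x) ∂P + ENNReal.ofReal (∫ x, G x ∂P) := by
  rw [ofReal_integral_eq_lintegral_ofReal hG (ae_of_all _ hG0),
    ← lintegral_add_right' _ hG.aestronglyMeasurable.aemeasurable.ennreal_ofReal]
  exact lintegral_mono fun x => (ENNReal.ofReal_le_ofReal (hfg x)).trans ENNReal.ofReal_add_le

theorem theorem4 (𝓧 : ℕ → Type*) [∀ i, MetricSpace (𝓧 i)] [∀ i, HadamardSpace (𝓧 i)]
    [∀ i, MeasurableSpace (𝓧 i)] [∀ i, BorelSpace (𝓧 i)]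
    (σ : ℝ) (m : ℕ → ℝ)
    (P : (n : ℕ) → Measure (ProdSpace 𝓧 n)) (hP : ∀ n, 1 ≤ n → P n ∈ momentFamily 𝓧 σ m n)
    (θ : (n : ℕ) → ProdSpace 𝓧 n) (hθ : ∀ n, 1 ≤ n → θ n ∈ frechetMean prodDist (P n))
    (ψ : (n : ℕ) → ProdSpace 𝓧 n) :
    (Tendsto (fun n => prodDist (θ n) (ψ n) ^ 2) atTop atTop →
      limsup (fun n => risk (P n) (θ n) (deltaJS σ (ψ n))) atTop = ENNReal.ofReal (σ ^ 2)) ∧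
    (Tendsto (fun n => risk (P n) (θ n) (fun x => x)) atTop (𝓝 (ENNReal.ofReal (σ ^ 2))) ∧
      limsup (fun n => risk (P n) (θ n) (deltaJS σ (ψ n))) atTop ≤ ENNReal.ofReal (σ ^ 2)) ∧
    (∀ ε : ℝ, 0 < ε →
      Tendsto (fun n => P n {x | σ ^ 2 + ε < loss (θ n) (deltaJS σ (ψ n) x)}) atTop (𝓝 0)) := by
  have hs : 0 < σ ^ 2 := (momentFamily_bounds le_rfl (hP 1 le_rfl) (hθ 1 le_rfl)).2.1
  have hrisk : ∀ n, 1 ≤ n → risk (P n) (θ n) (fun x => x) = ENNReal.ofReal (σ ^ 2) := by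
    intro n hn
    obtain ⟨_, -, -, -, hmem, hE, -⟩ := momentFamily_bounds hn (hP n hn) (hθ n hn)
    rw [← hE, ofReal_integral_eq_lintegral_ofReal ((hmem _).integrable (by norm_num))
      (ae_of_all _ fun x => by positivity)]
    rfl
  have hupper : limsup (fun n => risk (P n) (θ n) (deltaJS σ (ψ n))) atTop ≤
      ENNReal.ofReal (σ ^ 2) := by
    refine ENNReal.le_of_forall_pos_le_add fun ε hε _ => limsup_le_of_le (by isBoundedDefault) ?_
    have hε' : (0 : ℝ) < ε := hε
    filter_upwards [eventually_ge_atTop 1,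
      (tendsto_const_div_atTop_nhds_zero_nat _).eventually_le_const (half_pos hε')] with n hn hK
    obtain ⟨_, -⟩ := momentFamily_bounds hn (hP n hn) (hθ n hn)
    -- With η = ε/6 the term 3η uses half of ε, leaving ε/2 for the mean of G.
    obtain ⟨G, hG, hG0, hGi, hGle⟩ := exists_integrable_loss_deltaJS_le hn (hP n hn) (hθ n hn)
      (ψ n) (η := ε / 6) (by positivity)
    refine (lintegral_ofReal_le_of_le_add hG hG0 hGle).trans ?_
    rw [lintegral_const, measure_univ, mul_one, ← ENNReal.ofReal_add (by positivity)
      (integral_nonneg hG0), ← ENNReal.ofReal_coe_nnreal (p := ε),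
      ← ENNReal.ofReal_add hs.le hε'.le]
    exact ENNReal.ofReal_le_ofReal (by linarith [hGi.trans hK])
  refine ⟨fun hr => le_antisymm hupper ?_, ⟨?_, hupper⟩, fun ε hε => ?_⟩
  · refine ENNReal.le_of_forall_pos_le_add fun ε hε _ => ?_
    have hε' : (0 : ℝ) < ε := hε
    rw [← tsub_le_iff_right]
    refine le_limsup_of_frequently_le (Eventually.frequently ?_) (by isBoundedDefault)
    have hlim : Tendsto (fun n => σ ^ 2 / (2 * (ε / (4 * σ ^ 2))) *
        ((σ ^ 2 + 1) / (prodDist (θ n) (ψ n) ^ 2 + σ ^ 2) + (8 * m 2 + 2 * m 4 / σ ^ 2) / n))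
        atTop (𝓝 0) := by
      have := (((tendsto_atTop_add_const_right _ (σ ^ 2) hr).const_div_atTop (σ ^ 2 + 1)).add
        (tendsto_const_div_atTop_nhds_zero_nat (8 * m 2 + 2 * m 4 / σ ^ 2))).const_mul
          (σ ^ 2 / (2 * (ε / (4 * σ ^ 2))))
      simpa using this
    filter_upwards [eventually_ge_atTop 1, hlim.eventually_le_const (half_pos hε')] with n hn hK
    -- This η makes 2ησ² = ε/2; the rest of the mean of H tends to 0 because r → ∞ and n → ∞.
    obtain ⟨H, hH, hH0, hHi, hHle⟩ := exists_integrable_prodDist_sq_le hn (hP n hn) (hθ n hn)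
      (ψ n) (η := ε / (4 * σ ^ 2)) (by positivity)
    rw [tsub_le_iff_right, ← hrisk n hn]
    refine (lintegral_ofReal_le_of_le_add hH hH0 hHle).trans ?_
    rw [← ENNReal.ofReal_coe_nnreal (p := ε)]
    refine add_le_add le_rfl (ENNReal.ofReal_le_ofReal ?_)
    have hσ : σ ≠ 0 := by rintro rfl; simp at hs
    have : 2 * (ε / (4 * σ ^ 2)) * σ ^ 2 = (ε : ℝ) / 2 := by field_simp; norm_num
    linarith
  · exact tendsto_const_nhds.congr' (by
      filter_upwards [eventually_ge_atTop 1] with n hn using (hrisk n hn).symm)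
  · have hη : 0 < ε / 6 := by positivity
    have hlim := ENNReal.tendsto_ofReal ((tendsto_const_div_atTop_nhds_zero_nat
      (m 4 / (ε / 6) + (1 + σ ^ 2 / (4 * (ε / 6))) * (8 * m 2 + 2 * m 4 / σ ^ 2))).div_const
        (ε / 2))
    rw [zero_div, ENNReal.ofReal_zero] at hlim
    refine tendsto_of_tendsto_of_tendsto_of_le_of_le' tendsto_const_nhds hlim
      (Eventually.of_forall fun _ => zero_le) ?_
    filter_upwards [eventually_ge_atTop 1] with n hn
    obtain ⟨_, -⟩ := momentFamily_bounds hn (hP n hn) (hθ n hn)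
    obtain ⟨G, hG, hG0, hGi, hGle⟩ := exists_integrable_loss_deltaJS_le hn (hP n hn) (hθ n hn)
      (ψ n) hη
    -- Since 3η = ε/2, an excess above ε forces G ≥ ε/2, and Markov's inequality applies to G.
    have hsub : {x | σ ^ 2 + ε < loss (θ n) (deltaJS σ (ψ n) x)} ⊆ {x | ε / 2 ≤ G x} := by
      intro x hx
      have h1 := hGle x
      simp only [Set.mem_ofPred_eq] at hx ⊢
      linarith
    refine (measure_mono hsub).trans ?_
    rw [← ofReal_measureReal]
    refine ENNReal.ofReal_le_ofReal ?_
    rw [le_div_iff₀ (by positivity), mul_comm]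
    exact (mul_meas_ge_le_integral_of_nonneg (ae_of_all _ hG0) hG _).trans hGi
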